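/- **Theorem.** Let $E$ be a (real) Banach lattice with a quasi-interior point, i.e. an element $e\ge 0$ such that the order ideal $\{x\in E: |x|\le c\,e \text{ for some } c\in\mathbb{R}\}$ is norm dense in $E$. Let $\varepsilon>0$ and let $T$ be a bounded linear operator on $E$. Terminology. A *band* of $E$ is a linear subspace $Y$ such that $|x|\le|y|$, $y\in Y$ imply $x\in Y$, and such that the supremum of any subset of $Y$, if it exists in $E$, belongs to $Y$. A linear map $S:E\to E$ is *band preserving (BP)* if $S(Y)\subseteq Y$ for every band $Y$. A linear map $T$ is *$\varepsilon$-BP* if $\|\,|Tx|\wedge y\|\le\varepsilon\|x\|$ for all $x\in E$ and all $y\ge 0$ with $y\wedge|x|=0$. It is *locally $\varepsilon$-approximable by BP maps* if for every $x\in E$ there is a BP linear map $S_x$ with $\|Tx-S_xx\|\le\varepsilon\|x\|$. It is in the *$\varepsilon$-center* $\varepsilon\text{-}\mathcal Z(E)$ if there is $\lambda>0$ such that for every $x\in E$ with $\|x\|\le1$ there is $z\in E$ with $\|z\|\le\varepsilon$ and $|Tx|\le\lambda|x|+z$; in that case $$\rho_\varepsilon(T)=\inf\Big\{\lambda\ge0:\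 \sup_{\|x\|\le1}\big\|(|Tx|-\lambda|x|)_+\big\|\le\varepsilon\Big\}.$$ Then: 1. $T$ is $\varepsilon$-BP if and only if $T$ is locally $\varepsilon'$-approximable by BP maps for every $\varepsilon'>\varepsilon$. 2. (a) For every $C\in\mathbb{R}$: $T\in\varepsilon\text{-}\mathcal Z(E)$ with $\rho_\varepsilon(T)<C$ if and only if there is a constant $C'<C$ such that for every $x\in E$ with $\|x\|\le1$ and every $\varepsilon'>\varepsilon$ there is a bounded BP map $T_x$ on $E$ with $\|T_x\|\le C'$ and $\|Tx-T_xx\|<\varepsilon'$. (b) For every $C>0$: $T\in\varepsilon\text{-}\mathcal Z(E)$ with $\rho_\varepsilon(T)\le C$ if and only if for every $x\in E$ with $\|x\|\le1$ and every $\varepsilon'>\varepsilon$ there is a bounded BP map $T_x$ on $E$ with $\|T_x\|<C$ and $\|Tx-T_xx\|<\varepsilon'$. -/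

import Mathlib

noncomputable section

namespace AlmostBP

section Defs

variable {E : Type*} [NormedAddCommGroup E] [NormedSpace ℝ E] [Lattice E]

/-- A band: an order ideal (a solid linear subspace) that is closed under all suprema
existing in `E`. -/
structure IsBand (Y : Submodule ℝ E) : Prop where
  solid : ∀ ⦃x y : E⦄, y ∈ Y → |x| ≤ |y| → x ∈ Y
  sup_mem : ∀ ⦃A : Set E⦄ ⦃s : E⦄, A ⊆ (Y : Set E) → IsLUB A s → s ∈ Y

/-- A linear map is band preserving (BP) if it maps every band into itself. -/
def IsBP (S : E →ₗ[ℝ] E) : Prop :=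
  ∀ Y : Submodule ℝ E, IsBand Y → ∀ y ∈ Y, S y ∈ Y

/-- `T` is `ε`-band preserving: for every `x`, the number `ε * ‖x‖` is an upper bound of
`{‖|T x| ⊓ y‖ : y ≥ 0, y ⊥ x}`, where `y ⊥ x` means `|y| ⊓ |x| = 0`. -/
def IsEpsBP (ε : ℝ) (T : E →ₗ[ℝ] E) : Prop :=
  ∀ x y : E, 0 ≤ y → |y| ⊓ |x| = 0 → ‖|T x| ⊓ y‖ ≤ ε * ‖x‖

/-- `T` is locally `ε`-approximable by BP maps. -/
def IsLocallyApproxBP (ε : ℝ) (T : E →ₗ[ℝ] E) : Prop :=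
  ∀ x : E, ∃ S : E →ₗ[ℝ] E, IsBP S ∧ ‖T x - S x‖ ≤ ε * ‖x‖

/-- `T` belongs to the `ε`-center of `E`. -/
def MemEpsCenter (ε : ℝ) (T : E →ₗ[ℝ] E) : Prop :=
  ∃ l : ℝ, 0 < l ∧ ∀ x : E, ‖x‖ ≤ 1 → ∃ z : E, ‖z‖ ≤ ε ∧ |T x| ≤ l • |x| + z

/-- `ρ_ε(T)`: the infimum of all `l ≥ 0` such that `‖(|T x| - l |x|)₊‖ ≤ ε` for all `x` in the
closed unit ball. The set is nonempty when `T` is in the `ε`-center. -/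
def rho (ε : ℝ) (T : E →ₗ[ℝ] E) : ℝ :=
  sInf {l : ℝ | 0 ≤ l ∧ ∀ x : E, ‖x‖ ≤ 1 → ‖(|T x| - l • |x|)⁺‖ ≤ ε}

/-- `e` is a quasi-interior point: `e ≥ 0` and the order ideal generated by `e` is norm dense. -/
def IsQuasiInterior (e : E) : Prop :=
  0 ≤ e ∧ Dense {x : E | ∃ c : ℝ, |x| ≤ c • e}

end Defs

end AlmostBP

end

set_option linter.unusedSectionVars false

namespace AlmostBP

/-! ### Disjointness and truncation in lattice-ordered groups and vector lattices. -/

section Lattice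

variable {V : Type*} [AddCommGroup V] [Lattice V] [IsOrderedAddMonoid V]

/-! The heart is that the distance from `f` to `{S x : S bounded BP, ‖S‖ ≤ l}` equals `‖(|f| - l •
|x|)⁺‖`. For the lower bound, a bounded BP operator satisfies `|S x| ≤ ‖S‖ • |x|`
(`IsBP.abs_apply_le`), so `(|f| - l • |x|)⁺ ≤ |f - S x|`. For the upper bound, truncate `f` at `l •
|x|` to get `g`, then find a BP `S` with `‖S‖ ≤ l` and `S x` close to `g`
(`exists_central_norm_sub_le`). The principal ideal of a quasi-interior point dominating `|x|` is
represented by continuous functions on a compact space of lattice homomorphisms; there `S` is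
multiplication by a regularized quotient `g / x`, and density extends it to `E`.

With `f = T x`, part 2 follows once the infimum defining `rho` is known to be attained
(`mem_centerConstants_of_rho_le`). For part 1, `ε`-BP makes `‖(|T x| - n • |x|)⁺‖` at most barely
larger than `ε * ‖x‖` for large `n` (`IsEpsBP.exists_norm_posPart_lt`). Conversely, a BP map sends
`x` to something disjoint from every `y ⊥ x`, so `|T x| ⊓ y` is bounded by the approximation error.
-/

theorem add_inf_le_left_of_disjoint {a₁ a₂ b : V} (h₁ : 0 ≤ a₁) (h : a₂ ⊓ b = 0) :
    (a₁ + a₂) ⊓ b ≤ a₁ := by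
  calc (a₁ + a₂) ⊓ b ≤ (a₁ + a₂) ⊓ (a₁ + b) := inf_le_inf_left _ (le_add_of_nonneg_left h₁)
    _ = a₁ := by rw [← add_inf, h, add_zero]

theorem inf_eq_zero_mono {a a' b b' : V} (ha : 0 ≤ a') (hb : 0 ≤ b') (haa : a' ≤ a) (hbb : b' ≤ b)
    (h : a ⊓ b = 0) : a' ⊓ b' = 0 :=
  le_antisymm (h ▸ inf_le_inf haa hbb) (le_inf ha hb)

theorem add_eq_sup_of_inf_eq_zero {a b : V} (h : a ⊓ b = 0) : a + b = a ⊔ b := by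
  rw [← inf_add_sup a b, h, zero_add]

theorem abs_sub_of_inf_eq_zero {a b : V} (h : a ⊓ b = 0) : |a - b| = a ⊔ b := by
  rw [abs_sub_comm, ← sup_sub_inf_eq_abs_sub, h, sub_zero]

theorem abs_eq_posPart_sup_negPart (x : V) : |x| = x⁺ ⊔ x⁻ := by
  rw [← posPart_add_negPart, add_eq_sup_of_inf_eq_zero (posPart_inf_negPart_eq_zero x)]

/-- Truncation of `x` at the level `u`. -/
theorem exists_truncation (x : V) {u : V} (hu : 0 ≤ u) :
    ∃ p : V, |p| = |x| ⊓ u ∧ |x - p| = (|x| - u)⁺ := by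
  have hd := posPart_inf_negPart_eq_zero x
  have key (a : V) : a - a ⊓ u = (a - u)⁺ := by
    rw [sub_inf, sub_self, posPart_def, sup_comm]
  -- The positive and negative parts are truncated separately; they stay disjoint, so absolute
  -- values of differences become suprema.
  refine ⟨x⁺ ⊓ u - x⁻ ⊓ u, ?_, ?_⟩
  · rw [abs_sub_of_inf_eq_zero, abs_eq_posPart_sup_negPart]
    · let D := AddCommGroup.toDistribLattice V
      exact (@inf_sup_right V D _ _ _).symm
    · exact inf_eq_zero_mono (le_inf (posPart_nonneg x) hu) (le_inf (negPart_nonneg x) hu)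
        inf_le_left inf_le_left hd
  · have : x - (x⁺ ⊓ u - x⁻ ⊓ u) = (x⁺ - u)⁺ - (x⁻ - u)⁺ := by
      rw [← key, ← key]
      nth_rewrite 1 [← posPart_sub_negPart x]
      abel
    rw [this, abs_sub_of_inf_eq_zero, abs_eq_posPart_sup_negPart, sup_sub, posPart_def, posPart_def,
      posPart_def]
    · exact (sup_sup_distrib_right _ _ _).symm
    · exact inf_eq_zero_mono (posPart_nonneg _) (posPart_nonneg _)
        (sup_le (sub_le_self _ hu) (posPart_nonneg x))
        (sup_le (sub_le_self _ hu) (negPart_nonneg x)) hd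

theorem posPart_le_posPart_add_abs_sub (a b : V) : a⁺ ≤ b⁺ + |a - b| :=
  sup_le (by
    calc a = b + (a - b) := by abel
      _ ≤ b⁺ + |a - b| := add_le_add (le_posPart b) (le_abs_self _))
    (add_nonneg (posPart_nonneg b) (abs_nonneg _))

theorem abs_inf_le_abs_inf_add_abs_sub (a b y : V) :
    |a| ⊓ y ≤ |b| ⊓ y + |a - b| := by
  rw [add_comm, add_inf]
  refine inf_le_inf ?_ (le_add_of_nonneg_left (abs_nonneg _))
  calc |a| = |(a - b) + b| := by rw [sub_add_cancel]
    _ ≤ _ := abs_add_le _ _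

variable [Module ℝ V] [IsOrderedModule ℝ V]

theorem smul_sup_of_nonneg {c : ℝ} (hc : 0 ≤ c) (a b : V) : c • (a ⊔ b) = c • a ⊔ c • b := by
  rcases hc.eq_or_lt with rfl | hc
  · simp
  · exact (OrderIso.smulRight hc).map_sup a b

theorem smul_inf_of_nonneg {c : ℝ} (hc : 0 ≤ c) (a b : V) : c • (a ⊓ b) = c • a ⊓ c • b := by
  rcases hc.eq_or_lt with rfl | hc
  · simp
  · exact (OrderIso.smulRight hc).map_inf a b

theorem abs_smul_of_nonneg {c : ℝ} (hc : 0 ≤ c) (a : V) : |c • a| = c • |a| := by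
  rw [abs, abs, smul_sup_of_nonneg hc, smul_neg]

theorem abs_smul_eq (c : ℝ) (a : V) : |c • a| = |c| • |a| := by
  rcases le_total 0 c with hc | hc
  · rw [abs_smul_of_nonneg hc, abs_of_nonneg hc]
  · rw [← abs_neg, ← neg_smul, abs_smul_of_nonneg (by linarith), abs_of_nonpos hc]

theorem smul_inf_eq_zero {c : ℝ} (hc : 0 ≤ c) {a b : V} (ha : 0 ≤ a) (hb : 0 ≤ b)
    (h : a ⊓ b = 0) : c • a ⊓ b = 0 := by
  -- Enlarging both entries by the common factor `c ⊔ 1` lets the scalar come out of the infimum.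
  refine inf_eq_zero_mono (a := (c ⊔ 1) • a) (b := (c ⊔ 1) • b) (smul_nonneg hc ha) hb
    (smul_le_smul_of_nonneg_right le_sup_left ha) ?_ ?_
  · simpa using smul_le_smul_of_nonneg_right (le_sup_right : (1 : ℝ) ≤ c ⊔ 1) hb
  · rw [← smul_inf_of_nonneg (by positivity), h, smul_zero]

end Lattice

/-! ### Band preserving operators and their central bound. -/

section Band

variable {E : Type*} [NormedAddCommGroup E] [NormedSpace ℝ E] [Lattice E]
  [IsOrderedAddMonoid E]

/-- If `d = s⁺ ⊓ |y|`, then every `b ∈ A` has `b⁺` disjoint from `d`, whence `b + d ≤ s`. So `s - d`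
is again an upper bound, forcing `d = 0`. The empty set needs care: its supremum would be a least
element of `E`, hence `0`. -/
theorem disjoint_of_isLUB {A : Set E} {s y : E} (hA : ∀ a ∈ A, |a| ⊓ |y| = 0) (hs : IsLUB A s) :
    |s| ⊓ |y| = 0 := by
  rcases A.eq_empty_or_nonempty with rfl | ⟨a, ha⟩
  · have hle (z : E) : s ≤ z := hs.2 (by simp)
    have h0 : s = 0 := le_antisymm (hle 0) (by simpa using hle (s + s))
    simp [h0]
  · let D := AddCommGroup.toDistribLattice E
    have hneg : s⁻ ⊓ |y| = 0 :=
      inf_eq_zero_mono (negPart_nonneg s) (abs_nonneg y)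
        ((negPart_anti (hs.1 ha)).trans
          (by rw [← posPart_add_negPart]; exact le_add_of_nonneg_left (posPart_nonneg a)))
        le_rfl (hA a ha)
    have hpos : s⁺ ⊓ |y| = 0 := by
      set d := s⁺ ⊓ |y| with hd
      have hd0 : 0 ≤ d := le_inf (posPart_nonneg s) (abs_nonneg y)
      have hub : s ≤ s - d := by
        refine hs.2 fun b hb => ?_
        have h1 : b⁺ ⊓ d = 0 := inf_eq_zero_mono (posPart_nonneg b) hd0
          (by rw [← posPart_add_negPart]; exact le_add_of_nonneg_right (negPart_nonneg b))
          inf_le_right (hA b hb)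
        have h2 : b⁺ + d ≤ s⁺ := by
          rw [add_eq_sup_of_inf_eq_zero h1]
          exact sup_le (posPart_mono (hs.1 hb)) inf_le_left
        have h3 : s⁻ ≤ b⁻ := negPart_anti (hs.1 hb)
        rw [le_sub_iff_add_le]
        calc b + d = (b⁺ + d) - b⁻ := by nth_rewrite 1 [← posPart_sub_negPart b]; abel
          _ ≤ s⁺ - s⁻ := sub_le_sub h2 h3
          _ = s := posPart_sub_negPart s
      exact le_antisymm (by simpa using hub) hd0
    rw [abs_eq_posPart_sup_negPart]
    calc _ = s⁺ ⊓ |y| ⊔ s⁻ ⊓ |y| := @inf_sup_right E D _ _ _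
      _ = 0 := by rw [hpos, hneg, sup_idem]

variable [IsOrderedModule ℝ E]

/-- The disjoint complement of an element. -/
def disjointComplement (y : E) : Submodule ℝ E where
  carrier := {x | |x| ⊓ |y| = 0}
  zero_mem' := by simp
  add_mem' {a b} ha hb := by
    have h : (|a| + |b|) ⊓ |y| = 0 := by
      refine le_antisymm ?_ (le_inf (by positivity) (abs_nonneg _))
      rw [← (show |a| ⊓ |y| = 0 from ha)]
      exact le_inf (add_inf_le_left_of_disjoint (abs_nonneg a) hb) inf_le_right
    exact inf_eq_zero_mono (abs_nonneg _) (abs_nonneg _) (abs_add_le a b) le_rfl h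
  smul_mem' c x hx := by
    change |c • x| ⊓ |y| = 0
    rw [abs_smul_eq]
    exact smul_inf_eq_zero (abs_nonneg c) (abs_nonneg x) (abs_nonneg y) hx

theorem isBand_disjointComplement (y : E) : IsBand (disjointComplement y) where
  solid _ _ hy h := inf_eq_zero_mono (abs_nonneg _) (abs_nonneg _) h le_rfl hy
  sup_mem _ _ hA hs := disjoint_of_isLUB hA hs

theorem IsBP.disjoint {S : E →ₗ[ℝ] E} (hS : IsBP S) {x y : E} (h : |x| ⊓ |y| = 0) :
    |S x| ⊓ |y| = 0 :=
  hS _ (isBand_disjointComplement y) x h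

theorem isBP_of_abs_le {S : E →ₗ[ℝ] E} {C : ℝ} (hC : 0 ≤ C) (hS : ∀ x, |S x| ≤ C • |x|) :
    IsBP S := fun Y hY y hy =>
  hY.solid (Y.smul_mem C hy) (by rw [abs_smul_of_nonneg hC]; exact hS y)

variable [HasSolidNorm E]

theorem norm_le_of_abs_le_smul {a b : E} {C : ℝ} (hC : 0 ≤ C) (h : |a| ≤ C • |b|) :
    ‖a‖ ≤ C * ‖b‖ := by
  rw [← abs_smul_of_nonneg hC] at h
  simpa [norm_smul, abs_of_nonneg hC] using norm_le_norm_of_abs_le_abs h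

theorem le_of_forall_add_smul_le {a b u : E} (h : ∀ δ : ℝ, 0 < δ → a ≤ b + δ • u) : a ≤ b := by
  have ht : Filter.Tendsto (fun δ : ℝ => b + δ • u) (nhdsWithin 0 (Set.Ioi 0))
      (nhds (b + (0 : ℝ) • u)) :=
    ((continuous_const.add (continuous_id.smul continuous_const)).tendsto 0).mono_left
      nhdsWithin_le_nhds
  rw [zero_smul, add_zero] at ht
  exact ge_of_tendsto ht (by filter_upwards [self_mem_nhdsWithin] with δ hδ using h δ hδ)

/-- One step of the comparison of the parts of `x` lying over decreasing regions. -/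
theorem IsBP.smul_inf_le {S : E →ₗ[ℝ] E} (hS : IsBP S) {x e p : E} {c N r s : ℝ} (hc : 0 ≤ c)
    (hN : 0 < N) (hrs : r + 1 / N ≤ s) (he : |x| + |S x| ≤ e) (hr : 0 ≤ s)
    (hp : |x - p| = (|x| - N • ((|S x| - c • |x|)⁺ - r • e)⁺)⁺) :
    c • (|x| ⊓ N • ((|S x| - c • |x|)⁺ - s • e)⁺) ≤ |S p| := by
  set w := (|S x| - c • |x|)⁺ with hw
  have hw0 : 0 ≤ w := posPart_nonneg _
  have he0 : 0 ≤ e := (by positivity : 0 ≤ |x| + |S x|).trans he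
  have hxe : |x| ≤ e := le_trans (le_add_of_nonneg_right (abs_nonneg _)) he
  set b := (w - s • e)⁺ with hb
  have hb0 : 0 ≤ b := posPart_nonneg _
  have hbw : b ≤ w := sup_le (sub_le_self _ (smul_nonneg hr he0)) hw0
  -- the remainder `x - p` is disjoint from `b`
  have h1 : |x - p| ⊓ b = 0 := by
    -- Where `x - p` does not vanish, `N • (w - r • e)⁺ < |x| ≤ e`, so `w` lies below `(r + 1 / N) •
    -- e ≤ s • e`.
    have hle : |x - p| ≤ N • (w - s • e)⁻ := by
      rw [hp]
      refine sup_le ?_ (smul_nonneg hN.le (negPart_nonneg _))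
      calc |x| - N • (w - r • e)⁺ ≤ e - N • (w - r • e) :=
            sub_le_sub hxe (smul_le_smul_of_nonneg_left (le_posPart _) hN.le)
        _ = N • -(w - (r + 1 / N) • e) := by
            have h : N • (1 / N) • e = e := by rw [smul_smul, mul_one_div_cancel hN.ne', one_smul]
            nth_rewrite 1 [← h]
            module
        _ ≤ N • -(w - s • e) :=
            smul_le_smul_of_nonneg_left (neg_le_neg (sub_le_sub_left
              (smul_le_smul_of_nonneg_right hrs he0) _)) hN.le
        _ ≤ _ := smul_le_smul_of_nonneg_left (neg_le_negPart _) hN.le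
    refine inf_eq_zero_mono (abs_nonneg _) hb0 hle le_rfl
      (smul_inf_eq_zero hN.le (negPart_nonneg _) hb0 ?_)
    rw [inf_comm]
    exact posPart_inf_negPart_eq_zero _
  have h2 : |S (x - p)| ⊓ ((c * N) • b) = 0 := by
    have := hS.disjoint (x := x - p) (y := b) (by rwa [abs_of_nonneg hb0])
    rw [abs_of_nonneg hb0] at this
    rw [inf_comm]
    exact smul_inf_eq_zero (by positivity) hb0 (abs_nonneg _) (by rwa [inf_comm])
  -- On the region carrying `b` also `w > 0`, that is, `c • |x| < |S x|`.
  have h3 : (c • |x| - |S x|)⁺ ⊓ ((c * N) • b) = 0 := by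
    rw [inf_comm]
    refine smul_inf_eq_zero (by positivity) hb0 (posPart_nonneg _) ?_
    refine inf_eq_zero_mono hb0 (posPart_nonneg _) hbw le_rfl ?_
    rw [← neg_sub, posPart_neg]
    exact posPart_inf_negPart_eq_zero _
  calc c • (|x| ⊓ N • b) = c • |x| ⊓ (c * N) • b := by
        rw [smul_inf_of_nonneg hc, smul_smul]
    _ ≤ |S x| ⊓ (c * N) • b := by
        refine le_inf ?_ inf_le_right
        refine le_trans (inf_le_inf_right _ ?_)
          (add_inf_le_left_of_disjoint (abs_nonneg (S x)) h3)
        rw [← sub_le_iff_le_add']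
        exact le_posPart _
    _ ≤ |S p| := by
        refine le_trans (inf_le_inf_right _ ?_)
          (add_inf_le_left_of_disjoint (abs_nonneg (S p)) h2)
        calc |S x| = |S p + S (x - p)| := by rw [← map_add, add_sub_cancel]
          _ ≤ _ := abs_add_le _ _

/-- A bounded band preserving operator is central, with central norm at most its norm. -/
theorem IsBP.abs_apply_le (S : E →L[ℝ] E) (hS : IsBP (S : E →ₗ[ℝ] E)) (x : E) :
    |S x| ≤ ‖S‖ • |x| := by
  refine le_of_forall_add_smul_le (u := |x|) fun δ hδ => ?_
  rw [← add_smul]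
  set c := ‖S‖ + δ with hc
  have hc0 : 0 < c := by positivity
  set e := |x| + |S x| with he
  have he0 : 0 ≤ e := by positivity
  set w := (|S x| - c • |x|)⁺ with hw
  have hw0 : 0 ≤ w := posPart_nonneg _
  set q := ‖S‖ / c with hq
  have hq0 : 0 ≤ q := by positivity
  have hq1 : q < 1 := by rw [hq, div_lt_one hc0]; linarith
  -- Raising the level by `1 / N` shrinks the part of `x` over the region by the factor `q = ‖S‖ / c
  -- < 1`, since `c` times the next part is dominated by `S` of the current one.
  have hchain (N : ℝ) (hN : 0 < N) (k : ℕ) :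
      ‖|x| ⊓ N • (w - ((k : ℝ) / N) • e)⁺‖ ≤ q ^ k * ‖x‖ := by
    have hpos (k : ℕ) : 0 ≤ N • (w - ((k : ℝ) / N) • e)⁺ := smul_nonneg hN.le (posPart_nonneg _)
    induction k with
    | zero =>
      rw [pow_zero, one_mul]
      apply norm_le_norm_of_abs_le_abs
      rw [abs_of_nonneg (le_inf (abs_nonneg _) (hpos 0))]
      exact inf_le_left
    | succ k ih =>
      obtain ⟨p, hp1, hp2⟩ := exists_truncation x (hpos k)
      have h := IsBP.smul_inf_le hS (x := x) (e := e) (p := p) (s := ((k + 1 : ℕ) : ℝ) / N) hc0.le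
        hN (by push_cast; rw [add_div]) le_rfl (by positivity) hp2
      have h' := norm_le_norm_of_abs_le_abs (a := c • (|x| ⊓ N • (w - (((k + 1 : ℕ) : ℝ) / N) • e)⁺))
        (b := S p) (by
          rw [abs_of_nonneg (smul_nonneg hc0.le (le_inf (abs_nonneg _) (hpos _)))]
          exact h)
      rw [norm_smul, Real.norm_of_nonneg hc0.le] at h'
      have h4 : ‖S p‖ ≤ ‖S‖ * (q ^ k * ‖x‖) := by
        refine (S.le_opNorm p).trans (mul_le_mul_of_nonneg_left ?_ (norm_nonneg _))
        rw [← norm_abs_eq_norm p, hp1]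
        exact ih
      have h5 : q ^ (k + 1) * ‖x‖ = ‖S‖ * (q ^ k * ‖x‖) / c := by
        rw [pow_succ, hq]; ring
      rw [h5, le_div_iff₀ hc0, mul_comm]
      exact h'.trans h4
  have hzero (r : ℝ) (hr : 0 < r) : |x| ⊓ (w - r • e)⁺ = 0 := by
    have hb0 : 0 ≤ (w - r • e)⁺ := posPart_nonneg _
    rw [← norm_le_zero_iff]
    have ht : Filter.Tendsto (fun k : ℕ => q ^ k * ‖x‖) Filter.atTop (nhds 0) := by
      simpa using (tendsto_pow_atTop_nhds_zero_of_lt_one hq0 hq1).mul_const ‖x‖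
    refine ge_of_tendsto ht ?_
    filter_upwards [Filter.eventually_ge_atTop (⌈r⌉₊ + 1)] with k hk
    have hkr : r ≤ k := (Nat.le_ceil r).trans (by exact_mod_cast (Nat.le_succ _).trans hk)
    have hk0 : (0 : ℝ) < k := hr.trans_le hkr
    -- With `N = k / r`, exactly `k` steps lead to the fixed level `r`.
    have h := hchain (k / r) (by positivity) k
    rw [show (k : ℝ) / (k / r) = r by field_simp] at h
    refine le_trans (norm_le_norm_of_abs_le_abs ?_) h
    have hle : (w - r • e)⁺ ≤ ((k : ℝ) / r) • (w - r • e)⁺ := by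
      have := smul_le_smul_of_nonneg_right ((one_le_div hr).2 hkr) hb0
      rwa [one_smul] at this
    rw [abs_of_nonneg (le_inf (abs_nonneg _) hb0),
      abs_of_nonneg (le_inf (abs_nonneg _) (hb0.trans hle))]
    exact inf_le_inf_left _ hle
  have hxw : |x| ⊓ w = 0 := by
    refine le_antisymm (le_of_forall_add_smul_le (u := e) fun r hr => ?_)
      (le_inf (abs_nonneg _) hw0)
    rw [← hzero r hr, add_comm, add_inf]
    refine inf_le_inf (le_add_of_nonneg_left (smul_nonneg hr.le he0)) ?_
    rw [← sub_le_iff_le_add']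
    exact le_posPart _
  have hSw : |S x| ⊓ w = 0 := by
    have := hS.disjoint (x := x) (y := w) (by rwa [abs_of_nonneg hw0])
    rwa [abs_of_nonneg hw0] at this
  -- Now `w` is both below `|S x|` and disjoint from it, so it vanishes.
  have hwS : w ≤ |S x| := sup_le (sub_le_self _ (smul_nonneg hc0.le (abs_nonneg _))) (abs_nonneg _)
  rw [inf_eq_right.2 hwS, hw, posPart_eq_zero, sub_nonpos] at hSw
  exact hSw

end Band

/-! ### Lattice homomorphisms on a vector lattice with an order unit. -/

section Hom

variable {V : Type*} [AddCommGroup V] [Lattice V] [IsOrderedAddMonoid V] [Module ℝ V]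
  [IsOrderedModule ℝ V]

/-- A submodule that is an order ideal. -/
def IsOrderIdeal (M : Submodule ℝ V) : Prop :=
  ∀ ⦃x y : V⦄, y ∈ M → |x| ≤ |y| → x ∈ M

/-- The order ideal generated by an order ideal `M` and a positive element `w`. -/
def idealAdjoin (M : Submodule ℝ V) (w : V) (_hw : 0 ≤ w) : Submodule ℝ V where
  carrier := {x | ∃ m ∈ M, ∃ n : ℝ, 0 ≤ n ∧ 0 ≤ m ∧ |x| ≤ m + n • w}
  zero_mem' := ⟨0, M.zero_mem, 0, le_rfl, le_rfl, by simp⟩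
  add_mem' := by
    rintro a b ⟨m, hm, n, hn, hm0, h⟩ ⟨m', hm', n', hn', hm0', h'⟩
    refine ⟨m + m', M.add_mem hm hm', n + n', by positivity, by positivity, ?_⟩
    calc |a + b| ≤ |a| + |b| := abs_add_le _ _
      _ ≤ (m + n • w) + (m' + n' • w) := add_le_add h h'
      _ = _ := by module
  smul_mem' := by
    rintro c x ⟨m, hm, n, hn, hm0, h⟩
    refine ⟨|c| • m, M.smul_mem _ hm, |c| * n, by positivity, smul_nonneg (abs_nonneg c) hm0, ?_⟩
    rw [abs_smul_eq, mul_smul, ← smul_add]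
    exact smul_le_smul_of_nonneg_left h (abs_nonneg c)

theorem isOrderIdeal_idealAdjoin (M : Submodule ℝ V) (w : V) (hw : 0 ≤ w) :
    IsOrderIdeal (idealAdjoin M w hw) := by
  rintro x y ⟨m, hm, n, hn, hm0, h⟩ hxy
  exact ⟨m, hm, n, hn, hm0, hxy.trans h⟩

theorem mem_idealAdjoin_self (M : Submodule ℝ V) (w : V) (hw : 0 ≤ w) :
    w ∈ idealAdjoin M w hw :=
  ⟨0, M.zero_mem, 1, zero_le_one, le_rfl, by simp [abs_of_nonneg hw]⟩

theorem IsOrderIdeal.abs_mem {M : Submodule ℝ V} (hM : IsOrderIdeal M) {x : V} (hx : x ∈ M) :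
    |x| ∈ M := hM hx (abs_abs x).le

theorem IsOrderIdeal.le_idealAdjoin {M : Submodule ℝ V} (hM : IsOrderIdeal M) (w : V)
    (hw : 0 ≤ w) : M ≤ idealAdjoin M w hw := fun x hx =>
  ⟨|x|, hM.abs_mem hx, 0, le_rfl, abs_nonneg x, by simp⟩

theorem IsOrderIdeal.mem_of_le {M : Submodule ℝ V} (hM : IsOrderIdeal M) {x y : V} (hy : y ∈ M)
    (hx : 0 ≤ x) (h : x ≤ y) : x ∈ M :=
  hM hy (by rwa [abs_of_nonneg hx, abs_of_nonneg (hx.trans h)])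

/-- Order ideals are contained in order ideals that are maximal among those missing `e`. -/
theorem exists_maximal_ideal {e : V} {M₀ : Submodule ℝ V} (hM₀ : IsOrderIdeal M₀) (he : e ∉ M₀) :
    ∃ M, M₀ ≤ M ∧ Maximal (fun M : Submodule ℝ V => IsOrderIdeal M ∧ e ∉ M) M := by
  refine zorn_le_nonempty₀ {M : Submodule ℝ V | IsOrderIdeal M ∧ e ∉ M} ?_ M₀ ⟨hM₀, he⟩
  intro c hc hchain y hy
  have hmem {z : V} : z ∈ sSup c ↔ ∃ M ∈ c, z ∈ M :=
    Submodule.mem_sSup_of_directed ⟨y, hy⟩ hchain.directedOn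
  refine ⟨sSup c, ⟨?_, ?_⟩, fun z hz => le_sSup hz⟩
  · intro x z hz hxz
    obtain ⟨M, hM, hzM⟩ := hmem.1 hz
    exact hmem.2 ⟨M, hM, (hc hM).1 hzM hxz⟩
  · intro h
    obtain ⟨M, hM, heM⟩ := hmem.1 h
    exact (hc hM).2 heM

section MaximalIdeal

variable {e : V} {M : Submodule ℝ V}
  (hM : Maximal (fun M : Submodule ℝ V => IsOrderIdeal M ∧ e ∉ M) M)

include hM

/-- Adjoining `w` gives a strictly larger order ideal, which by maximality must contain `e`. -/
theorem exists_le_add_smul_of_maximal {w : V} (hw : 0 ≤ w) (hwM : w ∉ M) :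
    ∃ m ∈ M, ∃ n : ℝ, 0 ≤ n ∧ 0 ≤ m ∧ e ≤ m + n • w := by
  by_contra hcon
  have he : e ∉ idealAdjoin M w hw := by
    rintro ⟨m, hm, n, hn, hm0, h⟩
    exact hcon ⟨m, hm, n, hn, hm0, (le_abs_self e).trans h⟩
  exact hwM (hM.2 ⟨isOrderIdeal_idealAdjoin M w hw, he⟩ (hM.1.1.le_idealAdjoin w hw)
    (mem_idealAdjoin_self M w hw))

/-- Maximal ideals are prime: otherwise `e` lies below `m + n • w⁺` and below `m' + n' • w⁻`, and
disjointness of the two parts leaves `e ≤ m + m'`. -/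
theorem posPart_mem_or_negPart_mem (he : 0 ≤ e) (w : V) : w⁺ ∈ M ∨ w⁻ ∈ M := by
  by_contra! hcon
  obtain ⟨m, hm, n, hn, hm0, h⟩ := exists_le_add_smul_of_maximal hM (posPart_nonneg w) hcon.1
  obtain ⟨m', hm', n', hn', hm0', h'⟩ :=
    exists_le_add_smul_of_maximal hM (negPart_nonneg w) hcon.2
  refine hM.1.2 (hM.1.1.mem_of_le (M.add_mem hm hm') he ?_)
  have hd : n • w⁺ ⊓ n' • w⁻ = 0 := by
    refine smul_inf_eq_zero hn (posPart_nonneg w) (smul_nonneg hn' (negPart_nonneg w)) ?_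
    rw [inf_comm]
    refine smul_inf_eq_zero hn' (negPart_nonneg w) (posPart_nonneg w) ?_
    rw [inf_comm]
    exact posPart_inf_negPart_eq_zero w
  calc e ≤ (m + m' + n • w⁺) ⊓ (m + m' + n' • w⁻) :=
        le_inf (h.trans (by rw [add_right_comm]; exact le_add_of_nonneg_right hm0'))
          (h'.trans (by rw [add_assoc]; exact le_add_of_nonneg_left hm0))
    _ = m + m' := by rw [← add_inf, hd, add_zero]

/-- The quotient by `M` is the line spanned by `e`. The coordinate `t` is a Dedekind cut: just above
it the positive part is in `M`, just below it primeness puts the negative part in `M`. -/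
theorem exists_sub_smul_mem (he : 0 ≤ e) (hunit : ∀ u : V, ∃ c : ℝ, |u| ≤ c • e) (u : V) :
    ∃ t : ℝ, u - t • e ∈ M := by
  obtain ⟨K, hK⟩ := hunit u
  obtain ⟨hM1, heM⟩ := hM.1
  set A := {c : ℝ | (u - c • e)⁺ ∈ M} with hA
  have hKA : K ∈ A := by
    have : (u - K • e)⁺ = 0 := by
      rw [posPart_eq_zero, sub_nonpos]
      exact (le_abs_self u).trans hK
    simp [hA, this]
  have hbdd : BddBelow A := by
    refine ⟨-K, fun c (hc : (u - c • e)⁺ ∈ M) => ?_⟩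
    by_contra! hcK
    refine heM ?_
    have h1 : (-K - c) • e ∈ M := by
      refine hM1.mem_of_le hc (smul_nonneg (by linarith) he) (le_trans ?_ (le_posPart _))
      rw [sub_smul, neg_smul]
      exact sub_le_sub_right (neg_le.1 ((neg_le_abs u).trans hK)) _
    exact (M.smul_mem_iff (by linarith : -K - c ≠ 0)).1 h1
  set t := sInf A with ht
  refine ⟨t, ?_⟩
  by_contra hcon
  have hcon' : |u - t • e| ∉ M := fun h => hcon (hM1 h (abs_abs _).ge)
  obtain ⟨m, hm, n, hn, hm0, h⟩ := exists_le_add_smul_of_maximal hM (abs_nonneg _) hcon'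
  -- Small enough that `n * δ < 1`, so the term `(n * δ) • e` can be absorbed on the left.
  set δ := 1 / (2 * (n + 1)) with hδ
  have hδ0 : 0 < δ := by positivity
  have hup : (u - (t + δ) • e)⁺ ∈ M := by
    obtain ⟨c, hc, hct⟩ := exists_lt_of_csInf_lt ⟨K, hKA⟩ (by linarith : sInf A < t + δ)
    exact hM1.mem_of_le hc (posPart_nonneg _)
      (posPart_mono (sub_le_sub_left (smul_le_smul_of_nonneg_right hct.le he) _))
  have hlow : (u - (t - δ) • e)⁻ ∈ M := by
    refine (posPart_mem_or_negPart_mem hM he (u - (t - δ) • e)).resolve_left fun hmem => ?_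
    have : t ≤ t - δ := csInf_le hbdd hmem
    linarith
  set a := (u - (t + δ) • e)⁺ with ha
  set b := (u - (t - δ) • e)⁻ with hb
  have ha0 : 0 ≤ a := posPart_nonneg _
  have hb0 : 0 ≤ b := negPart_nonneg _
  have habs : |u - t • e| ≤ a + b + δ • e := by
    refine sup_le ?_ ?_
    · calc u - t • e = (u - (t + δ) • e) + 0 + δ • e := by module
        _ ≤ _ := by gcongr; exact le_posPart _
    · calc -(u - t • e) = 0 + -(u - (t - δ) • e) + δ • e := by module
        _ ≤ _ := by gcongr; exact neg_le_negPart _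
  have hhalf : (1 - n * δ) • e ≤ m + n • (a + b) := by
    rw [sub_smul, one_smul, sub_le_iff_le_add]
    calc e ≤ m + n • |u - t • e| := h
      _ ≤ m + n • (a + b + δ • e) := by
        gcongr
      _ = _ := by module
  have hnδ : n * δ < 1 := by
    rw [hδ, mul_one_div, div_lt_one (by positivity)]; linarith
  exact heM ((M.smul_mem_iff (by linarith : (1 - n * δ) ≠ 0)).1
    (hM1.mem_of_le (M.add_mem hm (M.smul_mem n (M.add_mem hup hlow)))
      (smul_nonneg (by linarith) he) hhalf))

end MaximalIdeal

/-- Real-valued lattice homomorphisms that are normalized at `e`. -/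
structure IsUnitalHom (e : V) (φ : V → ℝ) : Prop where
  map_add : ∀ u v, φ (u + v) = φ u + φ v
  map_smul : ∀ (c : ℝ) u, φ (c • u) = c * φ u
  map_sup : ∀ u v, φ (u ⊔ v) = φ u ⊔ φ v
  map_unit : φ e = 1

theorem abs_sup_sub_sup_le_add (a b c d : V) : |a ⊔ b - c ⊔ d| ≤ |a - c| + |b - d| := by
  calc |a ⊔ b - c ⊔ d| = |(a ⊔ b - c ⊔ b) + (c ⊔ b - c ⊔ d)| := by congr 1; abel
    _ ≤ |a ⊔ b - c ⊔ b| + |c ⊔ b - c ⊔ d| := abs_add_le _ _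
    _ ≤ _ := by
      refine add_le_add (abs_sup_sub_sup_le_abs a c b) ?_
      rw [sup_comm c b, sup_comm c d]
      exact abs_sup_sub_sup_le_abs b d c

/-- `φ u` is the coordinate of `u` in the one-dimensional quotient by `M`; uniqueness of the
coordinate gives every algebraic identity. -/
theorem exists_isUnitalHom_of_maximal {e : V} {M : Submodule ℝ V} (he : 0 ≤ e)
    (hunit : ∀ u : V, ∃ c : ℝ, |u| ≤ c • e)
    (hM : Maximal (fun M : Submodule ℝ V => IsOrderIdeal M ∧ e ∉ M) M) :
    ∃ φ : V → ℝ, IsUnitalHom e φ ∧ ∀ u, u - φ u • e ∈ M := by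
  choose φ hφ using exists_sub_smul_mem hM he hunit
  have huniq {u : V} {t : ℝ} (h : u - t • e ∈ M) : φ u = t := by
    by_contra hne
    have h1 : (φ u - t) • e ∈ M := by
      convert M.sub_mem h (hφ u) using 1
      module
    exact hM.1.2 ((M.smul_mem_iff (sub_ne_zero.2 hne)).1 h1)
  refine ⟨φ, ⟨fun u v => huniq ?_, fun c u => huniq ?_, fun u v => huniq ?_, huniq (by simp)⟩, hφ⟩
  · convert M.add_mem (hφ u) (hφ v) using 1
    module
  · convert M.smul_mem c (hφ u) using 1
    module
  · have hsup : (φ u ⊔ φ v) • e = φ u • e ⊔ φ v • e := by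
      rcases le_total (φ u) (φ v) with h | h
      · rw [sup_eq_right.2 h, sup_eq_right.2 (smul_le_smul_of_nonneg_right h he)]
      · rw [sup_eq_left.2 h, sup_eq_left.2 (smul_le_smul_of_nonneg_right h he)]
    rw [hsup]
    refine hM.1.1 (M.add_mem (hM.1.1.abs_mem (hφ u)) (hM.1.1.abs_mem (hφ v))) ?_
    rw [abs_of_nonneg (by positivity : 0 ≤ |u - φ u • e| + |v - φ v • e|)]
    exact abs_sup_sub_sup_le_add _ _ _ _

/-- There are enough normalized lattice homomorphisms to detect the order. -/
theorem exists_isUnitalHom_le {e : V} (he : 0 ≤ e) (hunit : ∀ u : V, ∃ c : ℝ, |u| ≤ c • e)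
    {u : V} {c : ℝ} (hu : ¬ u ≤ c • e) : ∃ φ : V → ℝ, IsUnitalHom e φ ∧ c ≤ φ u := by
  set w := u - c • e with hw
  -- The homomorphism should kill `w⁻`. If the ideal of `w⁻` contained `e`, then `w⁺` would be below
  -- a multiple of the disjoint `w⁻`, so `w⁺ = 0`, contrary to `hu`.
  have heI : e ∉ idealAdjoin ⊥ w⁻ (negPart_nonneg w) := by
    rintro ⟨m, hm, n, hn, -, h⟩
    rw [Submodule.mem_bot] at hm
    rw [hm, zero_add, abs_of_nonneg he] at h
    refine hu (sub_nonpos.1 (posPart_eq_zero.1 ?_))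
    obtain ⟨K, hK⟩ := hunit w
    have hdisj : w⁺ ⊓ (|K| * n) • w⁻ = 0 := by
      rw [inf_comm]
      refine smul_inf_eq_zero (by positivity) (negPart_nonneg w) (posPart_nonneg w) ?_
      rw [inf_comm]
      exact posPart_inf_negPart_eq_zero w
    have hle : w⁺ ≤ (|K| * n) • w⁻ := by
      calc w⁺ ≤ |w| := sup_le (le_abs_self w) (abs_nonneg w)
        _ ≤ K • e := hK
        _ ≤ |K| • e := smul_le_smul_of_nonneg_right (le_abs_self K) he
        _ ≤ _ := by rw [mul_smul]; exact smul_le_smul_of_nonneg_left h (abs_nonneg K)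
    rwa [inf_eq_left.2 hle] at hdisj
  obtain ⟨M, hle, hM⟩ := exists_maximal_ideal (isOrderIdeal_idealAdjoin _ _ _) heI
  obtain ⟨φ, hφ, hφM⟩ := exists_isUnitalHom_of_maximal he hunit hM
  refine ⟨φ, hφ, ?_⟩
  by_contra! hlt
  have hwM : w⁻ ∈ M := hle (mem_idealAdjoin_self _ _ _)
  have h1 : (c - φ u) • e ≤ w⁻ + |u - φ u • e| := by
    calc (c - φ u) • e = -w + (u - φ u • e) := by rw [hw]; module
      _ ≤ _ := add_le_add (neg_le_negPart w) (le_abs_self _)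
  exact hM.1.2 ((M.smul_mem_iff (sub_ne_zero.2 hlt.ne')).1
    (hM.1.1.mem_of_le (M.add_mem hwM (hM.1.1.abs_mem (hφM u)))
      (smul_nonneg (sub_nonneg.2 hlt.le) he) h1))

/-- The compact space of normalized lattice homomorphisms. -/
abbrev HomSpace (e : V) : Type _ := ↥{φ : V → ℝ | IsUnitalHom e φ}

theorem IsUnitalHom.mono {e : V} {φ : V → ℝ} (h : IsUnitalHom e φ) {u v : V} (huv : u ≤ v) :
    φ u ≤ φ v := by
  have := h.map_sup u v
  rw [sup_eq_right.2 huv] at this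
  rw [this]
  exact le_sup_left

theorem IsUnitalHom.map_neg {e : V} {φ : V → ℝ} (h : IsUnitalHom e φ) (u : V) :
    φ (-u) = -φ u := by
  simpa using h.map_smul (-1) u

theorem IsUnitalHom.map_abs {e : V} {φ : V → ℝ} (h : IsUnitalHom e φ) (u : V) :
    φ |u| = |φ u| := by
  rw [abs, h.map_sup, h.map_neg, abs]

theorem IsUnitalHom.map_inf {e : V} {φ : V → ℝ} (h : IsUnitalHom e φ) (u v : V) :
    φ (u ⊓ v) = φ u ⊓ φ v := by
  rw [← neg_neg (u ⊓ v), neg_inf, h.map_neg, h.map_sup, h.map_neg, h.map_neg, neg_sup, neg_neg,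
    neg_neg]

/-- Tychonoff: the homomorphisms form a closed subset of a product of compact intervals. -/
theorem compactSpace_homSpace {e : V} (hunit : ∀ u : V, ∃ c : ℝ, |u| ≤ c • e) :
    CompactSpace (HomSpace e) := by
  choose K hK using hunit
  rw [← isCompact_iff_compactSpace]
  refine IsCompact.of_isClosed_subset
    (isCompact_univ_pi fun u => isCompact_Icc (a := -K u) (b := K u)) ?_ ?_
  · have : {φ : V → ℝ | IsUnitalHom e φ} = {φ | ∀ u v, φ (u + v) = φ u + φ v} ∩
        {φ | ∀ (c : ℝ) u, φ (c • u) = c * φ u} ∩ {φ | ∀ u v, φ (u ⊔ v) = φ u ⊔ φ v} ∩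
        {φ | φ e = 1} := by
      ext φ
      exact ⟨fun h => ⟨⟨⟨h.1, h.2⟩, h.3⟩, h.4⟩, fun h => ⟨h.1.1.1, h.1.1.2, h.1.2, h.2⟩⟩
    rw [this]
    simp only [Set.ofPred_forall]
    refine ((IsClosed.inter ?_ ?_).inter ?_).inter ?_
    · exact isClosed_iInter fun u => isClosed_iInter fun v => isClosed_eq (by fun_prop) (by fun_prop)
    · exact isClosed_iInter fun u => isClosed_iInter fun v => isClosed_eq (by fun_prop) (by fun_prop)
    · exact isClosed_iInter fun u => isClosed_iInter fun v => isClosed_eq (by fun_prop)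
        ((continuous_apply u).sup (continuous_apply v))
    · exact isClosed_eq (by fun_prop) (by fun_prop)
  · intro φ (h : IsUnitalHom e φ) u _
    have := h.mono (hK u)
    rw [h.map_abs, h.map_smul, h.map_unit, mul_one] at this
    exact abs_le.1 this

/-- The evaluation map into continuous functions on the space of homomorphisms. -/
def evalHom (e : V) : V →ₗ[ℝ] C(HomSpace e, ℝ) where
  toFun u := ⟨fun φ => φ.1 u, (continuous_apply u).comp continuous_subtype_val⟩
  map_add' u v := by ext φ; exact φ.2.map_add u v
  map_smul' c u := by ext φ; exact φ.2.map_smul c u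

@[simp]
theorem evalHom_apply (e u : V) (φ : HomSpace e) : evalHom e u φ = φ.1 u := rfl

theorem evalHom_sup (e u v : V) : evalHom e (u ⊔ v) = evalHom e u ⊔ evalHom e v := by
  ext φ
  exact φ.2.map_sup u v

theorem evalHom_abs (e u : V) : evalHom e |u| = |evalHom e u| := by
  ext φ
  exact φ.2.map_abs u

/-- Lattice form of Stone–Weierstrass. Values at two distinct points are interpolated by combining
`e` with an element separating them. -/
theorem denseRange_evalHom {e : V} (hunit : ∀ u : V, ∃ c : ℝ, |u| ≤ c • e) :
    DenseRange (evalHom e) := by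
  have := compactSpace_homSpace hunit
  rw [DenseRange, dense_iff_closure_eq]
  refine ContinuousMap.sublattice_closure_eq_top _ ⟨_, 0, rfl⟩ ?_ ?_ ?_
  · rintro _ ⟨u, rfl⟩ _ ⟨v, rfl⟩
    exact ⟨u ⊓ v, by ext φ; exact φ.2.map_inf u v⟩
  · rintro _ ⟨u, rfl⟩ _ ⟨v, rfl⟩
    exact ⟨u ⊔ v, evalHom_sup e u v⟩
  · intro f φ ψ
    by_cases h : φ = ψ
    · subst h
      refine ⟨_, ⟨f φ • e, rfl⟩, ?_⟩
      simp [φ.2.map_unit]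
    · obtain ⟨u, hu⟩ : ∃ u, φ.1 u ≠ ψ.1 u := by
        by_contra! hcon
        exact h (Subtype.ext (funext hcon))
      have hne : φ.1 u - ψ.1 u ≠ 0 := sub_ne_zero.2 hu
      refine ⟨_, ⟨((f φ - f ψ) / (φ.1 u - ψ.1 u)) • (u - ψ.1 u • e) + f ψ • e, rfl⟩, ?_, ?_⟩
      · simp only [evalHom_apply, sub_eq_add_neg, ← neg_smul, φ.2.map_smul, φ.2.map_add,
          φ.2.map_unit]
        field_simp [show φ.1 u + -ψ.1 u ≠ 0 from hne]
        ring
      · simp only [evalHom_apply, sub_eq_add_neg, ← neg_smul, ψ.2.map_smul, ψ.2.map_add,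
          ψ.2.map_unit]
        ring

end Hom

/-! ### Functional calculus on principal ideals and construction of central operators. -/

section Central

variable {E : Type*} [NormedAddCommGroup E] [NormedSpace ℝ E] [Lattice E] [IsOrderedAddMonoid E]
  [IsOrderedModule ℝ E]

/-- The order ideal generated by a positive element. -/
abbrev principalIdeal (e : E) (he : 0 ≤ e) : Submodule ℝ E := idealAdjoin ⊥ e he

theorem mem_principalIdeal {e : E} (he : 0 ≤ e) {x : E} :
    x ∈ principalIdeal e he ↔ ∃ c : ℝ, |x| ≤ c • e := by
  constructor
  · rintro ⟨m, hm, n, -, -, h⟩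
    rw [Submodule.mem_bot] at hm
    exact ⟨n, by simpa [hm] using h⟩
  · rintro ⟨c, hc⟩
    refine ⟨0, Submodule.zero_mem _, |c|, abs_nonneg c, le_rfl, ?_⟩
    rw [zero_add]
    exact hc.trans (smul_le_smul_of_nonneg_right (le_abs_self c) he)

theorem sup_mem_principalIdeal {e : E} (he : 0 ≤ e) {x y : E} (hx : x ∈ principalIdeal e he)
    (hy : y ∈ principalIdeal e he) : x ⊔ y ∈ principalIdeal e he := by
  have hI := isOrderIdeal_idealAdjoin ⊥ e he
  refine hI (Submodule.add_mem _ (hI.abs_mem hx) (hI.abs_mem hy)) ?_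
  rw [abs_of_nonneg (by positivity : 0 ≤ |x| + |y|)]
  simpa using abs_sup_sub_sup_le_add x y 0 0

instance (e : E) (he : 0 ≤ e) : Lattice (principalIdeal e he) :=
  Subtype.lattice (fun _ _ hx hy => sup_mem_principalIdeal he hx hy) (fun x y hx hy => by
    rw [← neg_neg (x ⊓ y), neg_inf]
    exact Submodule.neg_mem _ (sup_mem_principalIdeal he (Submodule.neg_mem _ hx)
      (Submodule.neg_mem _ hy)))

instance (e : E) (he : 0 ≤ e) : IsOrderedModule ℝ (principalIdeal e he) where
  smul_le_smul_of_nonneg_left c hc u v h := by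
    have h' : (u : E) ≤ v := h
    exact (smul_le_smul_of_nonneg_left h' hc : c • (u : E) ≤ c • (v : E))
  smul_le_smul_of_nonneg_right u hu c d h := by
    have h' : (0 : E) ≤ u := hu
    exact (smul_le_smul_of_nonneg_right h h' : c • (u : E) ≤ d • (u : E))

/-- The generator, as an element of its principal ideal. -/
abbrev principalUnit (e : E) (he : 0 ≤ e) : principalIdeal e he :=
  ⟨e, mem_idealAdjoin_self _ _ _⟩

theorem coe_abs_principalIdeal {e : E} (he : 0 ≤ e) (u : principalIdeal e he) :
    ((|u| : principalIdeal e he) : E) = |(u : E)| := rfl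

theorem exists_abs_le_smul_principalUnit {e : E} (he : 0 ≤ e) (u : principalIdeal e he) :
    ∃ c : ℝ, |u| ≤ c • principalUnit e he := (mem_principalIdeal he).1 u.2

variable [HasSolidNorm E]

theorem le_norm_smul_principalUnit {e : E} (he : 0 ≤ e)
    [CompactSpace (HomSpace (principalUnit e he))] (u : principalIdeal e he) :
    (u : E) ≤ ‖evalHom (principalUnit e he) u‖ • e := by
  refine le_of_forall_add_smul_le (u := e) fun δ hδ => ?_
  rw [← add_smul]
  by_contra hcon
  obtain ⟨φ, hφ, hle⟩ := exists_isUnitalHom_le (e := principalUnit e he) he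
    (exists_abs_le_smul_principalUnit he) (u := u) (c := ‖evalHom (principalUnit e he) u‖ + δ) hcon
  have := (le_abs_self _).trans ((evalHom (principalUnit e he) u).norm_coe_le_norm ⟨φ, hφ⟩)
  rw [evalHom_apply] at this
  linarith

theorem norm_le_norm_evalHom {e : E} (he : 0 ≤ e)
    [CompactSpace (HomSpace (principalUnit e he))] (u : principalIdeal e he) :
    ‖(u : E)‖ ≤ ‖e‖ * ‖evalHom (principalUnit e he) u‖ := by
  rw [mul_comm]
  refine norm_le_of_abs_le_smul (norm_nonneg _) ?_
  rw [abs_of_nonneg he]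
  refine sup_le (le_norm_smul_principalUnit he u) ?_
  simpa using le_norm_smul_principalUnit he (-u)

variable [CompleteSpace E]

/-- The functional calculus: the positive map from continuous functions on the space of
homomorphisms that inverts the evaluation map. -/
noncomputable def homSpaceToBanach (e : E) (he : 0 ≤ e) [CompactSpace (HomSpace (principalUnit e he))] :
    C(HomSpace (principalUnit e he), ℝ) →L[ℝ] E :=
  (principalIdeal e he).subtype.extendOfNorm (evalHom (principalUnit e he))

section FunctionalCalculus

variable {e : E} (he : 0 ≤ e) [CompactSpace (HomSpace (principalUnit e he))]

theorem homSpaceToBanach_evalHom (u : principalIdeal e he) :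
    homSpaceToBanach e he (evalHom (principalUnit e he) u) = u :=
  LinearMap.extendOfNorm_eq (denseRange_evalHom (exists_abs_le_smul_principalUnit he))
    ⟨‖e‖, norm_le_norm_evalHom he⟩ u

theorem homSpaceToBanach_nonneg {g : C(HomSpace (principalUnit e he), ℝ)} (hg : 0 ≤ g) :
    0 ≤ homSpaceToBanach e he g := by
  -- Stated for `f ⊔ 0`, positivity is a closed condition on an unrestricted `f`, so density of the
  -- range suffices.
  suffices h : ∀ f, 0 ≤ homSpaceToBanach e he (f ⊔ 0) by simpa [sup_eq_left.2 hg] using h g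
  refine (denseRange_evalHom (exists_abs_le_smul_principalUnit he)).induction ?_ ?_
  · rintro _ ⟨u, rfl⟩
    rw [← map_zero (evalHom (principalUnit e he)), ← evalHom_sup, homSpaceToBanach_evalHom]
    exact (le_sup_right : (0 : principalIdeal e he) ≤ u ⊔ 0)
  · let s : C(ℝ, ℝ) := ⟨fun t => t ⊔ 0, continuous_id.sup continuous_const⟩
    exact isClosed_le continuous_const
      ((homSpaceToBanach e he).continuous.comp (ContinuousMap.continuous_postcomp s))

theorem homSpaceToBanach_mono {f g : C(HomSpace (principalUnit e he), ℝ)} (h : f ≤ g) :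
    homSpaceToBanach e he f ≤ homSpaceToBanach e he g := by
  rw [← sub_nonneg, ← map_sub]
  exact homSpaceToBanach_nonneg he (sub_nonneg.2 h)

theorem abs_homSpaceToBanach_mul_le {h : C(HomSpace (principalUnit e he), ℝ)} {C : ℝ}
    (hC : ∀ φ, |h φ| ≤ C) (u : principalIdeal e he) :
    |homSpaceToBanach e he (h * evalHom (principalUnit e he) u)| ≤ C • |(u : E)| := by
  rw [← coe_abs_principalIdeal, ← homSpaceToBanach_evalHom he |u|, ← map_smul, evalHom_abs]
  have hle (φ) : |h φ * φ.1 u| ≤ C * |φ.1 u| := by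
    rw [abs_mul]
    exact mul_le_mul_of_nonneg_right (hC φ) (abs_nonneg _)
  refine sup_le (homSpaceToBanach_mono he fun φ => (le_abs_self _).trans (hle φ)) ?_
  rw [← map_neg]
  exact homSpaceToBanach_mono he fun φ => (neg_le_abs _).trans (hle φ)

/-- Bounded continuous multipliers extend to central operators. -/
theorem exists_central_of_multiplier (hd : Dense (principalIdeal e he : Set E))
    {h : C(HomSpace (principalUnit e he), ℝ)} {C : ℝ} (hC0 : 0 ≤ C) (hC : ∀ φ, |h φ| ≤ C) :
    ∃ S : E →L[ℝ] E, (∀ x, |S x| ≤ C • |x|) ∧ ∀ u : principalIdeal e he,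
      S u = homSpaceToBanach e he (h * evalHom (principalUnit e he) u) := by
  let f : principalIdeal e he →ₗ[ℝ] E := (homSpaceToBanach e he).toLinearMap ∘ₗ
    LinearMap.mulLeft ℝ h ∘ₗ evalHom (principalUnit e he)
  have hf (u) : f u = homSpaceToBanach e he (h * evalHom (principalUnit e he) u) := rfl
  have hd' : DenseRange (principalIdeal e he).subtype := by simpa [DenseRange] using hd
  have hS (u : principalIdeal e he) : f.extendOfNorm (principalIdeal e he).subtype u = f u :=
    LinearMap.extendOfNorm_eq hd'
      ⟨C, fun u => norm_le_of_abs_le_smul hC0 (abs_homSpaceToBanach_mul_le he hC u)⟩ u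
  refine ⟨f.extendOfNorm (principalIdeal e he).subtype, ?_, hS⟩
  refine hd'.induction ?_ ?_
  · rintro _ ⟨u, rfl⟩
    rw [Submodule.subtype_apply, hS]
    exact abs_homSpaceToBanach_mul_le he hC u
  · have habs : Continuous fun x : E => |x| := continuous_id.sup continuous_neg
    exact isClosed_le (habs.comp (ContinuousLinearMap.continuous _)) (habs.const_smul C)

end FunctionalCalculus

/-- On a Banach lattice with a quasi-interior point the orbits of the center are dense in the
order ideals that they generate, with control of the norm. -/
theorem exists_central_norm_sub_le (hE : ∃ e : E, IsQuasiInterior e) {x g : E} {C η : ℝ}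
    (hC : 0 ≤ C) (hη : 0 < η) (hg : |g| ≤ C • |x|) :
    ∃ S : E →L[ℝ] E, (∀ u, |S u| ≤ C • |u|) ∧ ‖S x - g‖ ≤ η := by
  obtain ⟨e₀, he₀, hd₀⟩ := hE
  -- Still quasi-interior, and its principal ideal now contains `x` and `g`.
  set e := e₀ + |x| with he_def
  have he : 0 ≤ e := add_nonneg he₀ (abs_nonneg x)
  have hd : Dense (principalIdeal e he : Set E) := by
    refine hd₀.mono ?_
    rintro y ⟨c, hc⟩
    refine (mem_principalIdeal he).2 ⟨|c|, hc.trans ?_⟩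
    exact (smul_le_smul_of_nonneg_right (le_abs_self c) he₀).trans
      (smul_le_smul_of_nonneg_left (le_add_of_nonneg_right (abs_nonneg x)) (abs_nonneg c))
  have hxe : |x| ≤ e := le_add_of_nonneg_left he₀
  have hxI : x ∈ principalIdeal e he := (mem_principalIdeal he).2 ⟨1, by simpa using hxe⟩
  have hgI : g ∈ principalIdeal e he :=
    (mem_principalIdeal he).2 ⟨C, hg.trans (smul_le_smul_of_nonneg_left hxe hC)⟩
  have : CompactSpace (HomSpace (principalUnit e he)) :=
    compactSpace_homSpace (exists_abs_le_smul_principalUnit he)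
  set x' : principalIdeal e he := ⟨x, hxI⟩
  set g' : principalIdeal e he := ⟨g, hgI⟩
  set a := evalHom (principalUnit e he) x' with ha
  set b := evalHom (principalUnit e he) g' with hb
  have hab (φ) : |b φ| ≤ C * |a φ| := by
    have hle : |g'| ≤ C • |x'| := hg
    have := φ.2.mono hle
    rwa [φ.2.map_abs, φ.2.map_smul, φ.2.map_abs] at this
  set τ := η / ((C + 1) * (‖e‖ + 1)) with hτ
  have hτ0 : 0 < τ := by positivity
  have hpos (φ) : 0 < a φ ^ 2 + τ ^ 2 := by positivity
  -- A regularization of `b / a`: it is bounded by `C` because `|b| ≤ C * |a|`, and `h * a - b` has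
  -- size at most `C * τ` because `|a| * τ ≤ a ^ 2 + τ ^ 2`.
  let h : C(HomSpace (principalUnit e he), ℝ) :=
    ⟨fun φ => b φ * a φ / (a φ ^ 2 + τ ^ 2), by
      refine Continuous.div (by fun_prop) (by fun_prop) fun φ => (hpos φ).ne'⟩
  have hh (φ) : h φ = b φ * a φ / (a φ ^ 2 + τ ^ 2) := rfl
  have hhC (φ) : |h φ| ≤ C := by
    rw [hh, abs_div, abs_of_pos (hpos φ), div_le_iff₀ (hpos φ), abs_mul]
    calc |b φ| * |a φ| ≤ C * |a φ| * |a φ| := mul_le_mul_of_nonneg_right (hab φ) (abs_nonneg _)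
      _ = C * a φ ^ 2 := by rw [mul_assoc, abs_mul_abs_self, sq]
      _ ≤ _ := by gcongr; linarith [sq_nonneg τ]
  obtain ⟨S, hS, hSI⟩ := exists_central_of_multiplier he hd hC hhC
  refine ⟨S, hS, ?_⟩
  have hsub : S x - g = homSpaceToBanach e he (h * a - b) := by
    rw [map_sub, hb, homSpaceToBanach_evalHom]
    exact congrArg (· - g) (hSI x')
  have hsup (φ) : |(h * a - b) φ| ≤ C * τ := by
    have : (h * a - b) φ = -(b φ * τ ^ 2) / (a φ ^ 2 + τ ^ 2) := by
      rw [ContinuousMap.sub_apply, ContinuousMap.mul_apply, hh]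
      have := (hpos φ).ne'
      field_simp
      ring
    rw [this, abs_div, abs_of_pos (hpos φ), div_le_iff₀ (hpos φ), abs_neg, abs_mul,
      abs_of_pos (by positivity : 0 < τ ^ 2)]
    calc |b φ| * τ ^ 2 ≤ C * |a φ| * τ ^ 2 := by gcongr; exact hab φ
      _ = C * τ * (|a φ| * τ) := by ring
      _ ≤ C * τ * (a φ ^ 2 + τ ^ 2) := by
        gcongr
        rw [← sq_abs (a φ)]
        nlinarith [sq_nonneg (|a φ| - τ), sq_nonneg (|a φ|), sq_nonneg τ]
  have hcalc : |homSpaceToBanach e he (h * a - b)| ≤ (C * τ) • |e| := by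
    have h1 : (C * τ) • |e| = homSpaceToBanach e he
        ((C * τ) • evalHom (principalUnit e he) (principalUnit e he)) := by
      rw [map_smul, homSpaceToBanach_evalHom, abs_of_nonneg he]
    rw [h1]
    have h2 (φ) : ((C * τ) • evalHom (principalUnit e he) (principalUnit e he)) φ = C * τ := by
      rw [ContinuousMap.smul_apply, evalHom_apply, φ.2.map_unit, smul_eq_mul, mul_one]
    refine sup_le (homSpaceToBanach_mono he fun φ =>
      ((le_abs_self _).trans (hsup φ)).trans (h2 φ).ge) ?_
    rw [← map_neg]
    exact homSpaceToBanach_mono he fun φ => ((neg_le_abs _).trans (hsup φ)).trans (h2 φ).ge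
  rw [hsub]
  refine (norm_le_of_abs_le_smul (by positivity) hcalc).trans ?_
  have h3 : C * τ * ‖e‖ = η * (C * ‖e‖ / ((C + 1) * (‖e‖ + 1))) := by rw [hτ]; ring
  rw [h3]
  refine mul_le_of_le_one_right hη.le ?_
  rw [div_le_one (by positivity)]
  nlinarith [norm_nonneg e]

end Central

/-! ### Approximation by band preserving maps and the constants of the `ε`-center. -/

section Approximation

variable {E : Type*} [NormedAddCommGroup E] [NormedSpace ℝ E] [Lattice E] [IsOrderedAddMonoid E]
  [IsOrderedModule ℝ E] [HasSolidNorm E]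

theorem norm_mono {a b : E} (ha : 0 ≤ a) (h : a ≤ b) : ‖a‖ ≤ ‖b‖ :=
  norm_le_norm_of_abs_le_abs (by rwa [abs_of_nonneg ha, abs_of_nonneg (ha.trans h)])

/-- An element within distance `‖(|f| - l |x|)⁺‖` of `f` is attained from `x` by central
operators, up to an arbitrarily small error. -/
theorem exists_isBP_norm_sub_lt [CompleteSpace E] (hE : ∃ e : E, IsQuasiInterior e) {x f : E}
    {l d : ℝ} (hl : 0 ≤ l) (hd : ‖(|f| - l • |x|)⁺‖ < d) :
    ∃ S : E →L[ℝ] E, IsBP (S : E →ₗ[ℝ] E) ∧ ‖S‖ ≤ l ∧ ‖f - S x‖ < d := by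
  obtain ⟨g, hg, hfg⟩ := exists_truncation f (smul_nonneg hl (abs_nonneg x))
  obtain ⟨S, hS, hSx⟩ := exists_central_norm_sub_le hE (x := x) (g := g) hl
    (by linarith : 0 < (d - ‖(|f| - l • |x|)⁺‖) / 2) (hg.trans_le inf_le_right)
  refine ⟨S, isBP_of_abs_le hl hS,
    S.opNorm_le_bound hl fun u => norm_le_of_abs_le_smul hl (hS u), ?_⟩
  have h1 : ‖f - g‖ = ‖(|f| - l • |x|)⁺‖ := by rw [← norm_abs_eq_norm, hfg]
  calc ‖f - S x‖ ≤ ‖f - g‖ + ‖g - S x‖ := norm_sub_le_norm_sub_add_norm_sub _ _ _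
    _ < d := by rw [h1, norm_sub_rev g]; linarith

theorem isEpsBP_of_isLocallyApproxBP {ε : ℝ} {T : E →ₗ[ℝ] E}
    (h : ∀ ε' : ℝ, ε < ε' → IsLocallyApproxBP ε' T) : IsEpsBP ε T := by
  intro x y hy hxy
  have key (ε' : ℝ) (hε' : ε < ε') : ‖|T x| ⊓ y‖ ≤ ε' * ‖x‖ := by
    obtain ⟨S, hS, hSx⟩ := h ε' hε' x
    refine le_trans ?_ hSx
    rw [← norm_abs_eq_norm (T x - S x)]
    refine norm_mono (le_inf (abs_nonneg _) hy) ?_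
    have hdis : |S x| ⊓ |y| = 0 := hS.disjoint (by rwa [inf_comm])
    have := abs_inf_le_abs_inf_add_abs_sub (T x) (S x) y
    rwa [← abs_of_nonneg hy, hdis, zero_add, abs_of_nonneg hy] at this
  have ht : Filter.Tendsto (fun ε' : ℝ => ε' * ‖x‖) (nhdsWithin ε (Set.Ioi ε)) (nhds (ε * ‖x‖)) :=
    ((continuous_id.mul continuous_const).tendsto ε).mono_left nhdsWithin_le_nhds
  exact ge_of_tendsto ht (by filter_upwards [self_mem_nhdsWithin] with ε' h using key ε' h)

/-- For an `ε`-band preserving operator, the part of `T x` outside of large multiples of `|x|` has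
norm close to at most `ε ‖x‖`. -/
theorem IsEpsBP.exists_norm_posPart_lt (hE : ∃ e : E, IsQuasiInterior e) {ε : ℝ} (hε : 0 ≤ ε)
    {T : E →L[ℝ] E} (hT : IsEpsBP ε (T : E →ₗ[ℝ] E)) (x : E) {d : ℝ} (hd : ε * ‖x‖ < d) :
    ∃ n : ℝ, 0 ≤ n ∧ ‖(|T x| - n • |x|)⁺‖ < d := by
  obtain ⟨e, he, hdense⟩ := hE
  set η := (d - ε * ‖x‖) / 4 with hη
  have hη0 : 0 < η := by rw [hη]; linarith
  obtain ⟨f, hf, ⟨K, hK⟩⟩ := Metric.dense_iff.1 hdense (T x) η hη0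
  rw [Metric.mem_ball, dist_eq_norm] at hf
  -- Makes `‖T p‖ ≤ η` for the truncation `p` of `x` at `δ • e`.
  set δ := η / ((‖T‖ + 1) * (‖e‖ + 1)) with hδ
  have hδ0 : 0 < δ := by positivity
  have hδT : ‖T‖ * (δ * ‖e‖) ≤ η := by
    have : ‖T‖ * (δ * ‖e‖) = η * (‖T‖ * ‖e‖ / ((‖T‖ + 1) * (‖e‖ + 1))) := by rw [hδ]; ring
    rw [this]
    refine mul_le_of_le_one_right hη0.le ?_
    rw [div_le_one (by positivity)]
    nlinarith [norm_nonneg e, norm_nonneg T]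
  have hδe : 0 ≤ δ • e := smul_nonneg hδ0.le he
  obtain ⟨p, hp, hxp⟩ := exists_truncation x hδe
  -- Chosen so that `|f| ≤ |K| • e = n • (δ • e)`; hence `|f| - n • |x|` is at most `y`, which is
  -- disjoint from `x - p`.
  set n := |K| / δ with hn
  have hn0 : 0 ≤ n := by positivity
  refine ⟨n, hn0, ?_⟩
  set y := n • (|x| - δ • e)⁻ with hy
  have hy0 : 0 ≤ y := smul_nonneg hn0 (negPart_nonneg _)
  have hpn : ‖p‖ ≤ δ * ‖e‖ := norm_le_of_abs_le_smul hδ0.le (by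
    rw [hp, abs_of_nonneg he]; exact inf_le_right)
  have hxpn : ‖x - p‖ ≤ ‖x‖ := norm_le_norm_of_abs_le_abs (by
    rw [hxp]
    exact sup_le (sub_le_self _ hδe) (abs_nonneg x))
  have hdisj : |y| ⊓ |x - p| = 0 := by
    rw [abs_of_nonneg hy0, hxp]
    refine smul_inf_eq_zero hn0 (negPart_nonneg _) (posPart_nonneg _) ?_
    rw [inf_comm]
    exact posPart_inf_negPart_eq_zero _
  have h1 : ‖|T (x - p)| ⊓ y‖ ≤ ε * ‖x‖ :=
    (hT (x - p) y hy0 hdisj).trans (mul_le_mul_of_nonneg_left hxpn hε)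
  have h2 : (|f| - n • |x|)⁺ ≤ |f| ⊓ y := by
    refine le_inf (sup_le (sub_le_self _ (smul_nonneg hn0 (abs_nonneg x))) (abs_nonneg f))
      (sup_le ?_ hy0)
    calc |f| - n • |x| ≤ |K| • e - n • |x| :=
          sub_le_sub_right (hK.trans (smul_le_smul_of_nonneg_right (le_abs_self K) he)) _
      _ = n • -(|x| - δ • e) := by
          have : |K| = n * δ := by rw [hn]; field_simp
          rw [this]; module
      _ ≤ y := smul_le_smul_of_nonneg_left (neg_le_negPart _) hn0
  have h3 : ‖|T (x - p)| ⊓ y + |f - T (x - p)|‖ ≤ ε * ‖x‖ + 2 * η := by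
    refine (norm_add_le _ _).trans ?_
    rw [norm_abs_eq_norm]
    have : ‖f - T (x - p)‖ ≤ ‖f - T x‖ + ‖T p‖ := by
      rw [map_sub, ← sub_add]
      exact norm_add_le _ _
    have hTp : ‖T p‖ ≤ η := ((T.le_opNorm p).trans
      (mul_le_mul_of_nonneg_left hpn (norm_nonneg _))).trans hδT
    linarith
  have h4 : (|T x| - n • |x|)⁺ ≤ (|T (x - p)| ⊓ y + |f - T (x - p)|) + |T x - f| := by
    refine (posPart_le_posPart_add_abs_sub _ (|f| - n • |x|)).trans (add_le_add ?_ ?_)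
    · exact h2.trans (abs_inf_le_abs_inf_add_abs_sub _ _ _)
    · rw [sub_sub_sub_cancel_right]
      exact abs_abs_sub_abs_le _ _
  calc _ ≤ _ := norm_mono (posPart_nonneg _) h4
    _ ≤ _ := norm_add_le _ _
    _ < d := by
      rw [norm_abs_eq_norm, norm_sub_rev]
      linarith

theorem IsEpsBP.isLocallyApproxBP [CompleteSpace E] (hE : ∃ e : E, IsQuasiInterior e) {ε : ℝ}
    (hε : 0 ≤ ε) {T : E →L[ℝ] E} (hT : IsEpsBP ε (T : E →ₗ[ℝ] E)) {ε' : ℝ} (hε' : ε < ε') :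
    IsLocallyApproxBP ε' (T : E →ₗ[ℝ] E) := by
  intro x
  rcases eq_or_ne x 0 with rfl | hx
  · exact ⟨0, fun Y _ _ _ => Y.zero_mem, by simp⟩
  · have hlt : ε * ‖x‖ < ε' * ‖x‖ := mul_lt_mul_of_pos_right hε' (norm_pos_iff.2 hx)
    obtain ⟨n, hn0, hn⟩ := hT.exists_norm_posPart_lt hE hε x hlt
    obtain ⟨S, hS, -, hSx⟩ := exists_isBP_norm_sub_lt hE hn0 hn
    exact ⟨S, hS, hSx.le⟩

/-- The set of admissible constants in the definition of `rho`. -/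
def centerConstants (ε : ℝ) (T : E →ₗ[ℝ] E) : Set ℝ :=
  {l : ℝ | 0 ≤ l ∧ ∀ x : E, ‖x‖ ≤ 1 → ‖(|T x| - l • |x|)⁺‖ ≤ ε}

theorem bddBelow_centerConstants (ε : ℝ) (T : E →ₗ[ℝ] E) : BddBelow (centerConstants ε T) :=
  ⟨0, fun _ h => h.1⟩

theorem rho_le {ε : ℝ} {T : E →ₗ[ℝ] E} {l : ℝ} (h : l ∈ centerConstants ε T) : rho ε T ≤ l :=
  csInf_le (bddBelow_centerConstants ε T) h

theorem MemEpsCenter.nonempty_centerConstants {ε : ℝ} {T : E →ₗ[ℝ] E} (h : MemEpsCenter ε T) :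
    (centerConstants ε T).Nonempty := by
  obtain ⟨l, hl, h⟩ := h
  refine ⟨l, hl.le, fun x hx => ?_⟩
  obtain ⟨z, hz, hTz⟩ := h x hx
  refine le_trans ?_ hz
  rw [← norm_abs_eq_norm z]
  refine norm_mono (posPart_nonneg _) (sup_le ?_ (abs_nonneg z))
  rw [sub_le_iff_le_add']
  exact hTz.trans (add_le_add_right (le_abs_self z) _)

theorem memEpsCenter_of_mem {ε : ℝ} {T : E →ₗ[ℝ] E} {l : ℝ} (h : l ∈ centerConstants ε T) :
    MemEpsCenter ε T := by
  -- The definition wants a strictly positive constant, while `l` may be `0`.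
  refine ⟨l + 1, by linarith [h.1], fun x hx => ⟨(|T x| - l • |x|)⁺, h.2 x hx, ?_⟩⟩
  calc |T x| = l • |x| + (|T x| - l • |x|) := by abel
    _ ≤ _ := add_le_add (smul_le_smul_of_nonneg_right (by linarith) (abs_nonneg x)) (le_posPart _)

/-- The infimum is attained: lowering an admissible `l < C + η` to `C` costs at most `η * ‖x‖ ≤ η`
in norm. -/
theorem mem_centerConstants_of_rho_le {ε C : ℝ} {T : E →ₗ[ℝ] E} (h : MemEpsCenter ε T)
    (hC : rho ε T ≤ C) : C ∈ centerConstants ε T := by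
  have hne := h.nonempty_centerConstants
  refine ⟨le_trans (le_csInf hne fun _ h => h.1) hC, fun x hx => ?_⟩
  refine le_of_forall_pos_le_add fun η hη => ?_
  obtain ⟨l, hl, hlC⟩ := exists_lt_of_csInf_lt hne (hC.trans_lt (lt_add_of_pos_right C hη))
  have hle : (|T x| - C • |x|)⁺ ≤ (|T x| - l • |x|)⁺ + η • |x| := by
    refine sup_le ?_ (add_nonneg (posPart_nonneg _) (smul_nonneg hη.le (abs_nonneg x)))
    calc |T x| - C • |x| = (|T x| - (C + η) • |x|) + η • |x| := by module
      _ ≤ _ := add_le_add_left ((sub_le_sub_left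
          (smul_le_smul_of_nonneg_right hlC.le (abs_nonneg x)) _).trans (le_posPart _)) _
  calc _ ≤ _ := norm_mono (posPart_nonneg _) hle
    _ ≤ _ := norm_add_le _ _
    _ ≤ ε + η := by
      refine add_le_add (hl.2 x hx) ?_
      rw [norm_smul, norm_abs_eq_norm, Real.norm_of_nonneg hη.le]
      exact mul_le_of_le_one_right hη.le hx

theorem mem_centerConstants_of_approx {ε C : ℝ} {T : E →L[ℝ] E}
    (h : ∀ x : E, ‖x‖ ≤ 1 → ∀ ε' : ℝ, ε < ε' →
      ∃ S : E →L[ℝ] E, IsBP (S : E →ₗ[ℝ] E) ∧ ‖S‖ ≤ C ∧ ‖T x - S x‖ < ε') :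
    C ∈ centerConstants ε (T : E →ₗ[ℝ] E) := by
  constructor
  · obtain ⟨S, -, hS, -⟩ := h 0 (by simp) (ε + 1) (by linarith)
    exact (norm_nonneg S).trans hS
  · intro x hx
    refine le_of_forall_gt_imp_ge_of_dense fun ε' hε' => ?_
    obtain ⟨S, hS, hSC, hSx⟩ := h x hx ε' hε'
    refine le_trans ?_ hSx.le
    rw [← norm_abs_eq_norm (T x - S x)]
    refine norm_mono (posPart_nonneg _) (sup_le ?_ (abs_nonneg _))
    rw [sub_le_iff_le_add]
    calc |T x| = |(T x - S x) + S x| := by rw [sub_add_cancel]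
      _ ≤ |T x - S x| + |S x| := abs_add_le _ _
      _ ≤ _ := add_le_add le_rfl ((hS.abs_apply_le S x).trans
        (smul_le_smul_of_nonneg_right hSC (abs_nonneg x)))

theorem exists_isBP_of_mem_centerConstants [CompleteSpace E] (hE : ∃ e : E, IsQuasiInterior e)
    {ε C : ℝ} {T : E →L[ℝ] E} (hC : C ∈ centerConstants ε (T : E →ₗ[ℝ] E)) {x : E} (hx : ‖x‖ ≤ 1)
    {ε' : ℝ} (hε' : ε < ε') :
    ∃ S : E →L[ℝ] E, IsBP (S : E →ₗ[ℝ] E) ∧ ‖S‖ ≤ C ∧ ‖T x - S x‖ < ε' :=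
  exists_isBP_norm_sub_lt hE hC.1 ((hC.2 x hx).trans_lt hε')

/-- Approximants of norm at most `C` can be scaled down to have norm less than `C`. -/
theorem exists_isBP_norm_lt [CompleteSpace E] (hE : ∃ e : E, IsQuasiInterior e) {ε C : ℝ}
    (hC0 : 0 < C) {T : E →L[ℝ] E} (hC : C ∈ centerConstants ε (T : E →ₗ[ℝ] E)) {x : E}
    (hx : ‖x‖ ≤ 1) {ε' : ℝ} (hε' : ε < ε') :
    ∃ S : E →L[ℝ] E, IsBP (S : E →ₗ[ℝ] E) ∧ ‖S‖ < C ∧ ‖T x - S x‖ < ε' := by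
  obtain ⟨S, hS, hSC, hSx⟩ :=
    exists_isBP_of_mem_centerConstants hE hC hx (left_lt_add_div_two.2 hε' : ε < (ε + ε') / 2)
  set η := (ε' - ε) / 2 with hη
  have hη0 : 0 < η := by rw [hη]; linarith
  -- Scaling by `q` moves `S x` by at most `(1 - q) * C = η * q ≤ η`, half of the gap `ε' - ε`.
  set q := C / (C + η) with hq
  have hq0 : 0 < q := by positivity
  have hq1 : q < 1 := by rw [hq, div_lt_one (by positivity)]; linarith
  refine ⟨q • S, fun Y hY y hy => Y.smul_mem q (hS Y hY y hy), ?_, ?_⟩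
  · rw [norm_smul, Real.norm_of_nonneg hq0.le]
    calc q * ‖S‖ ≤ q * C := mul_le_mul_of_nonneg_left hSC hq0.le
      _ < C := by nlinarith
  · have h1 : ‖S x - (q • S) x‖ ≤ η := by
      have : S x - (q • S) x = (1 - q) • S x := by
        rw [smul_apply, sub_smul, one_smul]
      rw [this, norm_smul, Real.norm_of_nonneg (by linarith)]
      have h2 : ‖S x‖ ≤ C := (S.le_opNorm x).trans
        ((mul_le_of_le_one_right (norm_nonneg S) hx).trans hSC)
      have h3 : (1 - q) * C ≤ η := by
        have : (1 - q) * C = η * (C / (C + η)) := by rw [hq]; field_simp; ring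
        rw [this]
        exact mul_le_of_le_one_right hη0.le hq1.le
      exact (mul_le_mul_of_nonneg_left h2 (by linarith)).trans h3
    calc ‖T x - (q • S) x‖ ≤ ‖T x - S x‖ + ‖S x - (q • S) x‖ :=
          norm_sub_le_norm_sub_add_norm_sub _ _ _
      _ < ε' := by linarith

end Approximation

end AlmostBP

theorem theorem4p3 {E : Type*} [NormedAddCommGroup E] [NormedSpace ℝ E] [CompleteSpace E]
    [Lattice E] [IsOrderedAddMonoid E] [IsOrderedModule ℝ E] [HasSolidNorm E]
    (hE : ∃ e : E, AlmostBP.IsQuasiInterior e)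
    (ε : ℝ) (hε : 0 < ε) (T : E →L[ℝ] E) :
    (AlmostBP.IsEpsBP ε (T : E →ₗ[ℝ] E) ↔
      ∀ ε' : ℝ, ε < ε' → AlmostBP.IsLocallyApproxBP ε' (T : E →ₗ[ℝ] E)) ∧
    (∀ C : ℝ,
      (AlmostBP.MemEpsCenter ε (T : E →ₗ[ℝ] E) ∧ AlmostBP.rho ε (T : E →ₗ[ℝ] E) < C) ↔
        ∃ C' : ℝ, C' < C ∧ ∀ x : E, ‖x‖ ≤ 1 → ∀ ε' : ℝ, ε < ε' →
          ∃ S : E →L[ℝ] E, AlmostBP.IsBP (S : E →ₗ[ℝ] E) ∧ ‖S‖ ≤ C' ∧ ‖T x - S x‖ < ε') ∧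
    (∀ C : ℝ, 0 < C →
      ((AlmostBP.MemEpsCenter ε (T : E →ₗ[ℝ] E) ∧ AlmostBP.rho ε (T : E →ₗ[ℝ] E) ≤ C) ↔
        ∀ x : E, ‖x‖ ≤ 1 → ∀ ε' : ℝ, ε < ε' →
          ∃ S : E →L[ℝ] E, AlmostBP.IsBP (S : E →ₗ[ℝ] E) ∧ ‖S‖ < C ∧ ‖T x - S x‖ < ε')) := by
  refine ⟨⟨fun h ε' hε' => h.isLocallyApproxBP hE hε.le hε',
    AlmostBP.isEpsBP_of_isLocallyApproxBP⟩, fun C => ⟨?_, ?_⟩, fun C hC => ⟨?_, ?_⟩⟩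
  · rintro ⟨hT, hrho⟩
    -- Since the infimum is attained, `C'` can be `rho` itself.
    have hmem := AlmostBP.mem_centerConstants_of_rho_le hT le_rfl
    exact ⟨_, hrho, fun x hx ε' hε' =>
      AlmostBP.exists_isBP_of_mem_centerConstants hE hmem hx hε'⟩
  · rintro ⟨C', hC', h⟩
    have hmem := AlmostBP.mem_centerConstants_of_approx h
    exact ⟨AlmostBP.memEpsCenter_of_mem hmem, (AlmostBP.rho_le hmem).trans_lt hC'⟩
  · rintro ⟨hT, hrho⟩ x hx ε' hε'
    exact AlmostBP.exists_isBP_norm_lt hE hC (AlmostBP.mem_centerConstants_of_rho_le hT hrho)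
      hx hε'
  · intro h
    have hmem := AlmostBP.mem_centerConstants_of_approx (ε := ε) (C := C) (T := T)
      fun x hx ε' hε' => by
        obtain ⟨S, hS, hSC, hSx⟩ := h x hx ε' hε'
        exact ⟨S, hS, hSC.le, hSx⟩
    exact ⟨AlmostBP.memEpsCenter_of_mem hmem, AlmostBP.rho_le hmem⟩
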